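/- **Conventions.** Let $G$ be a finite graph, loops and multiple edges allowed, with vertex set $V$, $|V|=n$, and edges totally ordered as $e_1<\dots<e_m$. All representations are over $\mathbb C$, and symmetric functions are formal power series in $x_1,x_2,\dots$ with complex coefficients. Let $\mathfrak S_B$ be the symmetric group of a finite set $B$. For $|B|=b\ge 1$ let $\mathcal S^{(b-1,1)}=\{f\in\mathbb C^B:\sum_{v\in B}f(v)=0\}$ (which is $0$ for $b=1$), and let $\mathcal L_b=\bigwedge^*\mathcal S^{(b-1,1)}$, a graded $\mathfrak S_B$-module whose degree-$i$ part is the Specht module $\mathcal S^{(b-i,1^i)}$ for $0\le i\le b-1$. **Chain modules.** For $F\subseteq E(G)$ let $B_1,\dots,B_r$ be the vertex sets of the connected components of the spanning subgraph $(V,F)$, let $b_k=|B_k|$, and let $$\mathcal M_F=\operatorname{Ind}_{\mathfrak S_{B_1}\times\cdots\times\mathfrak S_{B_r}}^{\mathfrak S_V}\bigl(\mathcal L_{b_1}\otimes\cdots\otimes\mathcal L_{b_r}\bigr),\qquad \mathcal L_{b_1}\otimes\cdots\otimes\mathcal L_{b_r}=\textstyle\bigwedge^*\mathcal T_F,\quad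 \mathcal T_F=\bigoplus_{k}\mathcal S^{(b_k-1,1)},$$ a graded $\mathfrak S_V$-module. For $i,j\ge0$ let $C_{i,j}(G)=\bigoplus_{|F|=i}(\mathcal M_F)_j$. **Differential.** Let $e\in F$ and $F'=F\setminus\{e\}$. If $F$ and $F'$ have the same connected components, then $\mathcal M_F=\mathcal M_{F'}$, and $d_{F,e}:\mathcal M_F\to\mathcal M_{F'}$ is the identity. Otherwise one component of $F$ splits into two components of $F'$; as modules over the Young subgroup $Y'$ of the components of $F'$ one has $\mathcal T_F=\mathcal T_{F'}\oplus\mathbf 1$ with $\mathbf 1$ a trivial one-dimensional module, hence $\bigwedge^*\mathcal T_F=\bigwedge^*\mathcal T_{F'}\oplus(\bigwedge^*\mathcal T_{F'})[1]$, and $d_{F,e}$ is induced, via Frobenius reciprocity, by the map of $Y'$-modules that is the identity on $\bigwedge^*\mathcal T_{F'}$ and zero on $(\bigwedge^*\mathcal T_{F'})[1]$. Let $d_{i,j}:C_{i,j}(G)\to C_{i-1,j}(G)$ be the degree-$j$ part of $$\sum_{|F|=i}\ \sum_{e\in F}(-1)^{k(F,e)}d_{F,e},\qquad k(F,e)=\#\{e'\in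 F: e'>e\}.$$ These maps satisfy $d_{i,j}\circ d_{i+1,j}=0$. Let $H_{i,j}(G)=\ker d_{i,j}/\operatorname{im}d_{i+1,j}$ (with $d_{0,j}=0$), an $\mathfrak S_V$-module. **Frobenius series.** Let $\operatorname{ch}$ be the Frobenius characteristic, $\operatorname{ch}(W)=\frac1{n!}\sum_{\sigma\in\mathfrak S_V}\chi_W(\sigma)\,p_{\lambda(\sigma)}$, where $\lambda(\sigma)$ is the cycle type of $\sigma$ and $p_\lambda$ is the power sum symmetric function; equivalently, $\operatorname{ch}$ is additive and sends $\mathcal S^\lambda$ to the Schur function $s_\lambda$. Let $$\operatorname{Frob}_G(q,t)=\sum_{i,j\ge0}(-1)^{i+j}t^iq^j\operatorname{ch}\bigl(H_{i,j}(G)\bigr).$$ **Chromatic symmetric function.** Let $X_G=\sum_\kappa\prod_{v\in V}x_{\kappa(v)}$, the sum being over all proper colourings $\kappa$ of $G$ with positive integers as colours, that is, over all maps $\kappa:V\to\{1,2,\dots\}$ such that the two ends of every edge get different colours (there are none if $G$ has a loop). **Theorem.** For every finite graph $G$, $$\operatorname{Frob}_G(1,1)=X_G.$$ -/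

import Mathlib

open scoped Graph

noncomputable section

namespace ChromaticHomology

/-! ### Set partitions of the vertex set, and the modules attached to them

A set partition of `V` is recorded as a `Setoid V`; its blocks are the equivalence classes. -/

section Modules

variable {V : Type*}

/-- The Young subgroup `𝔖_{B₁} × ⋯ × 𝔖_{Bᵣ} ≤ 𝔖_V` of a set partition with blocks `B₁, …, Bᵣ`:
the permutations that map every block to itself. -/
def youngSubgroup (s : Setoid V) : Subgroup (Equiv.Perm V) where
  carrier := {g | ∀ v, s (g v) v}
  mul_mem' {a b} ha hb v := s.trans' (ha (b v)) (hb v)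
  one_mem' v := s.refl' v
  inv_mem' {a} ha v := by
    have h := ha (a⁻¹ v)
    have e : a (a⁻¹ v) = v := Equiv.apply_symm_apply a v
    rw [e] at h
    exact s.symm' h

lemma youngSubgroup_mono {s t : Setoid V} (h : t ≤ s) : youngSubgroup t ≤ youngSubgroup s :=
  fun _ hg v => h (hg v)

/-- The permutation representation of `𝔖_V` on `ℂ^V`: `(g f)(v) = f(g⁻¹ v)`. -/
def permRep (V : Type*) : Representation ℂ (Equiv.Perm V) (V → ℂ) where
  toFun g := LinearMap.funLeft ℂ ℂ (g⁻¹ : Equiv.Perm V)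
  map_one' := by ext; simp
  map_mul' a b := by ext; simp [LinearMap.funLeft_apply]

@[simp] lemma permRep_apply (g : Equiv.Perm V) (f : V → ℂ) (v : V) :
    permRep V g f v = f (g⁻¹ v) := rfl

open Classical in
/-- The sum of `f` over the block that contains `v`. -/
def blockSum [Fintype V] (s : Setoid V) (f : V → ℂ) (v : V) : ℂ := ∑ w with s w v, f w

open Classical in
/-- The size of the block that contains `v`. -/
def blockSize [Fintype V] (s : Setoid V) (v : V) : ℕ := Finset.card {w | s w v}

lemma blockSize_pos [Fintype V] (s : Setoid V) (v : V) : 0 < blockSize s v := by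
  classical
  exact Finset.card_pos.mpr ⟨v, by simp⟩

lemma blockSum_add [Fintype V] (s : Setoid V) (f g : V → ℂ) (v : V) :
    blockSum s (f + g) v = blockSum s f v + blockSum s g v := by
  simp [blockSum, Finset.sum_add_distrib]

lemma blockSum_smul [Fintype V] (s : Setoid V) (c : ℂ) (f : V → ℂ) (v : V) :
    blockSum s (c • f) v = c * blockSum s f v := by
  simp [blockSum, Finset.mul_sum]

lemma blockSum_congr [Fintype V] (s : Setoid V) (f : V → ℂ) {v w : V} (h : s v w) :
    blockSum s f v = blockSum s f w := by
  classical
  unfold blockSum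
  congr 1
  ext x
  simp only [Finset.mem_filter, Finset.mem_univ, true_and]
  exact ⟨fun hx => s.trans' hx h, fun hx => s.trans' hx (s.symm' h)⟩

lemma blockSize_congr [Fintype V] (s : Setoid V) {v w : V} (h : s v w) :
    blockSize s v = blockSize s w := by
  classical
  unfold blockSize
  congr 1
  ext x
  simp only [Finset.mem_filter, Finset.mem_univ, true_and]
  exact ⟨fun hx => s.trans' hx h, fun hx => s.trans' hx (s.symm' h)⟩

lemma blockSum_permRep [Fintype V] (s : Setoid V) {g : Equiv.Perm V} (hg : g ∈ youngSubgroup s)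
    (f : V → ℂ) (v : V) : blockSum s (permRep V g f) v = blockSum s f v := by
  classical
  unfold blockSum
  refine Finset.sum_equiv (g⁻¹ : Equiv.Perm V) (fun w => ?_) (fun w _ => rfl)
  have hw : s ((g⁻¹ : Equiv.Perm V) w) w := (youngSubgroup s).inv_mem hg w
  simp only [Finset.mem_filter, Finset.mem_univ, true_and]
  exact ⟨fun h => s.trans' hw h, fun h => s.trans' (s.symm' hw) h⟩

/-- The vectors in `ℂ^V` whose coordinates sum to zero over every block. This is
`⨁ₖ S^{(bₖ-1,1)}`, the direct sum over the blocks `Bₖ` of the reduced permutation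
representation `S^{(bₖ-1,1)}` of `𝔖_{Bₖ}` (zero for a block of size one), on which the other
factors of the Young subgroup act trivially. -/
def reducedSpace [Fintype V] (s : Setoid V) : Submodule ℂ (V → ℂ) where
  carrier := {f | ∀ v, blockSum s f v = 0}
  add_mem' {f g} hf hg v := by rw [blockSum_add, hf v, hg v, add_zero]
  zero_mem' v := by simp [blockSum]
  smul_mem' c f hf v := by rw [blockSum_smul, hf v, mul_zero]

/-- The action of the Young subgroup on `⨁ₖ S^{(bₖ-1,1)}`. -/
def reducedRep [Fintype V] (s : Setoid V) :
    Representation ℂ (youngSubgroup s) (reducedSpace s) :=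
  Representation.subrepresentation ((permRep V).comp (youngSubgroup s).subtype) (reducedSpace s)
    (fun g f hf v => (blockSum_permRep s g.2 f v).trans (hf v))

@[simp] lemma coe_reducedRep_apply [Fintype V] (s : Setoid V) (g : youngSubgroup s)
    (f : reducedSpace s) : (reducedRep s g f : V → ℂ) = permRep V g f := rfl

/-- The `j`-th exterior power of a representation. -/
def extRep {H W : Type*} [Monoid H] [AddCommGroup W] [Module ℂ W]
    (ρ : Representation ℂ H W) (j : ℕ) : Representation ℂ H (⋀[ℂ]^j W) where
  toFun g := exteriorPower.map j (ρ g)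
  map_one' := by rw [map_one]; exact exteriorPower.map_id
  map_mul' a b := by
    rw [map_mul, Module.End.mul_eq_comp, Module.End.mul_eq_comp, exteriorPower.map_comp]

@[simp] lemma extRep_apply {H W : Type*} [Monoid H] [AddCommGroup W] [Module ℂ W]
    (ρ : Representation ℂ H W) (j : ℕ) (g : H) : extRep ρ j g = exteriorPower.map j (ρ g) := rfl

/-- The space underlying `partRep`. -/
def PartModule [Fintype V] (s : Setoid V) (j : ℕ) : Type _ :=
  Representation.coindV (youngSubgroup s).subtype (extRep (reducedRep s) j)

instance [Fintype V] (s : Setoid V) (j : ℕ) : AddCommGroup (PartModule s j) :=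
  inferInstanceAs (AddCommGroup
    (Representation.coindV (youngSubgroup s).subtype (extRep (reducedRep s) j)))

instance [Fintype V] (s : Setoid V) (j : ℕ) : Module ℂ (PartModule s j) :=
  inferInstanceAs (Module ℂ
    (Representation.coindV (youngSubgroup s).subtype (extRep (reducedRep s) j)))

/-- The degree-`j` part of `Ind_{𝔖_{B₁} × ⋯ × 𝔖_{Bᵣ}}^{𝔖_V} (L_{b₁} ⊗ ⋯ ⊗ L_{bᵣ})`, where
`L_b = Λ* S^{(b-1,1)} = ⨁ᵢ S^{(b-i,1^i)}` with `S^{(b-i,1^i)}` in degree `i`.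
Here `L_{b₁} ⊗ ⋯ ⊗ L_{bᵣ}` is taken in the form `Λ* (⨁ₖ S^{(bₖ-1,1)})`. The representation
induced from a subgroup `Y` of the finite group `𝔖_V` is realized on the functions
`f : 𝔖_V → A` with `f (y σ) = y • f σ` for `y ∈ Y`, on which `τ ∈ 𝔖_V` acts by
`(τ f)(σ) = f (σ τ)`; in this form the map that Frobenius reciprocity attaches to
`φ : Res M → A` is `m ↦ (σ ↦ φ (σ m))`. (See `Rep.indCoindIso` for the isomorphism with the
coinvariants of `ℂ[𝔖_V] ⊗ A`.) -/
def partRep [Fintype V] (s : Setoid V) (j : ℕ) :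
    Representation ℂ (Equiv.Perm V) (PartModule s j) :=
  Representation.coind (youngSubgroup s).subtype (extRep (reducedRep s) j)

/-! ### The per-edge maps -/

/-- Subtracting from `f` its average over each block of `t`: the projection of `ℂ^V` onto
`reducedSpace t` along the vectors that are constant on the blocks of `t`. -/
def centre [Fintype V] (t : Setoid V) : (V → ℂ) →ₗ[ℂ] (V → ℂ) where
  toFun f v := f v - blockSum t f v / blockSize t v
  map_add' f g := by
    funext v
    simp only [blockSum_add, Pi.add_apply]
    ring
  map_smul' c f := by
    funext v
    simp only [blockSum_smul, Pi.smul_apply, smul_eq_mul, RingHom.id_apply]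
    ring

lemma centre_apply [Fintype V] (t : Setoid V) (f : V → ℂ) (v : V) :
    centre t f v = f v - blockSum t f v / blockSize t v := rfl

/-- `centre t` is the identity on `reducedSpace t`. -/
lemma centre_of_mem [Fintype V] {t : Setoid V} {f : V → ℂ} (hf : f ∈ reducedSpace t) :
    centre t f = f := by
  funext v
  rw [centre_apply, hf v, zero_div, sub_zero]

lemma blockSum_of_const [Fintype V] {t : Setoid V} {f : V → ℂ}
    (hf : ∀ v w, t v w → f v = f w) (v : V) : blockSum t f v = blockSize t v * f v := by
  classical
  unfold blockSum blockSize
  rw [Finset.sum_congr rfl (g := fun _ => f v)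
    (fun w hw => hf w v (Finset.mem_filter.mp hw).2), Finset.sum_const, nsmul_eq_mul]

/-- `centre t` kills the vectors that are constant on the blocks of `t`. -/
lemma centre_of_const [Fintype V] {t : Setoid V} {f : V → ℂ}
    (hf : ∀ v w, t v w → f v = f w) : centre t f = 0 := by
  have h0 : ∀ v, (blockSize t v : ℂ) ≠ 0 := fun v =>
    Nat.cast_ne_zero.mpr (blockSize_pos t v).ne'
  funext v
  rw [centre_apply, blockSum_of_const hf, mul_div_cancel_left₀ _ (h0 v), sub_self, Pi.zero_apply]

lemma centre_mem [Fintype V] (t : Setoid V) (f : V → ℂ) : centre t f ∈ reducedSpace t := by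
  intro v
  have h0 : (blockSize t v : ℂ) ≠ 0 := Nat.cast_ne_zero.mpr (blockSize_pos t v).ne'
  have h1 : blockSum t (fun w => blockSum t f w / (blockSize t w : ℂ)) v
      = blockSize t v * (blockSum t f v / blockSize t v) :=
    blockSum_of_const (fun a b hab => by
      simp only [blockSum_congr t f hab, blockSize_congr t hab]) v
  have h2 : centre t f = f + (-1 : ℂ) • (fun w => blockSum t f w / (blockSize t w : ℂ)) := by
    funext w
    simp [centre_apply, sub_eq_add_neg]
  rw [h2, blockSum_add, blockSum_smul, h1, mul_div_cancel₀ _ h0]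
  ring

lemma centre_permRep [Fintype V] (t : Setoid V) {g : Equiv.Perm V} (hg : g ∈ youngSubgroup t)
    (f : V → ℂ) : centre t (permRep V g f) = permRep V g (centre t f) := by
  funext v
  have hv : t ((g⁻¹ : Equiv.Perm V) v) v := (youngSubgroup t).inv_mem hg v
  rw [centre_apply, blockSum_permRep t hg, permRep_apply, permRep_apply, centre_apply,
    blockSum_congr t f hv, blockSize_congr t hv]

/-- The restriction of `centre t` to a map `⨁ₖ S^{(bₖ-1,1)} → ⨁ₗ S^{(b'ₗ-1,1)}`, the blocks of `s`
having sizes `bₖ` and those of `t` having sizes `b'ₗ`. If the partition `t` arises from `s` by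
cutting one block into blocks `A` and `B`, then, as a module over the Young subgroup of `t`, the
source is `T ⊕ 𝟏` with `T = reducedSpace t` and `𝟏` the trivial module spanned by
`|B|·1_A - |A|·1_B`, and this is the projection onto `T`. -/
def splitMap [Fintype V] (s t : Setoid V) : reducedSpace s →ₗ[ℂ] reducedSpace t :=
  ((centre t).comp (reducedSpace s).subtype).codRestrict (reducedSpace t)
    (fun f => centre_mem t f)

lemma splitMap_reducedRep [Fintype V] {s t : Setoid V} (h : t ≤ s) (g : youngSubgroup t)
    (f : reducedSpace s) :
    splitMap s t (reducedRep s ⟨g, youngSubgroup_mono h g.2⟩ f) =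
      reducedRep t g (splitMap s t f) :=
  Subtype.ext (centre_permRep t g.2 (f : V → ℂ))

/-- The per-edge map `Ind Λʲ(reducedSpace s) → Ind Λʲ(reducedSpace t)` for a partition `t` finer
than `s`. For `t = s` it is the identity. If `t` arises from `s` by cutting one block in two,
it is induced by the map of modules over the Young subgroup of `t` which on
`Λ*(T ⊕ 𝟏) = Λ*T ⊕ (Λ*T)[1]` is the identity on `Λ*T` and zero on `(Λ*T)[1]`. -/
def perEdge [Fintype V] {s t : Setoid V} (h : t ≤ s) (j : ℕ) :
    (partRep s j).IntertwiningMap (partRep t j) :=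
  LinearMap.intertwiningMap_of_isIntertwiningMap _ _
    (((exteriorPower.map j (splitMap s t)).compLeft (Equiv.Perm V)).restrict
      (p := Representation.coindV (youngSubgroup s).subtype (extRep (reducedRep s) j))
      (q := Representation.coindV (youngSubgroup t).subtype (extRep (reducedRep t) j))
      (fun f hf g σ => by
        have h1 : f (g * σ) = exteriorPower.map j
            (reducedRep s ⟨g, youngSubgroup_mono h g.2⟩) (f σ) :=
          hf ⟨g, youngSubgroup_mono h g.2⟩ σ
        have h2 : splitMap s t ∘ₗ reducedRep s ⟨g, youngSubgroup_mono h g.2⟩ =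
            reducedRep t g ∘ₗ splitMap s t := LinearMap.ext (splitMap_reducedRep h g)
        change exteriorPower.map j (splitMap s t) (f (g * σ)) =
          exteriorPower.map j (reducedRep t g) (exteriorPower.map j (splitMap s t) (f σ))
        rw [h1, ← LinearMap.comp_apply, ← LinearMap.comp_apply, ← exteriorPower.map_comp,
          ← exteriorPower.map_comp, h2]))
    (fun _ _ => rfl)

lemma perEdge_apply [Fintype V] {s t : Setoid V} (h : t ≤ s) (j : ℕ) (x : PartModule s j)
    (σ : Equiv.Perm V) :
    (perEdge h j x).1 σ = exteriorPower.map j (splitMap s t) (x.1 σ) := rfl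

lemma perEdge_refl [Fintype V] (s : Setoid V) (j : ℕ) (x : PartModule s j) :
    perEdge (le_refl s) j x = x := by
  have h : splitMap s s = LinearMap.id :=
    LinearMap.ext fun f => Subtype.ext (centre_of_mem f.2)
  refine Subtype.ext (funext fun σ => ?_)
  rw [perEdge_apply, h, exteriorPower.map_id, LinearMap.id_apply]

lemma splitMap_comp [Fintype V] {s t u : Setoid V} (h : u ≤ t) :
    splitMap t u ∘ₗ splitMap s t = splitMap s u := by
  refine LinearMap.ext fun f => Subtype.ext ?_
  change centre u (centre t f) = centre u f
  have h2 : centre u (fun w => blockSum t (f : V → ℂ) w / (blockSize t w : ℂ)) = 0 :=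
    centre_of_const fun a b hab => by
      rw [blockSum_congr t _ (h hab), blockSize_congr t (h hab)]
  have h3 : centre t (f : V → ℂ) =
      (f : V → ℂ) - (fun w => blockSum t (f : V → ℂ) w / (blockSize t w : ℂ)) := rfl
  rw [h3, map_sub, h2, sub_zero]

lemma perEdge_comp [Fintype V] {s t u : Setoid V} (h : t ≤ s) (h' : u ≤ t) (j : ℕ)
    (x : PartModule s j) : perEdge h' j (perEdge h j x) = perEdge (h'.trans h) j x := by
  refine Subtype.ext (funext fun σ => ?_)
  rw [perEdge_apply, perEdge_apply, perEdge_apply, ← LinearMap.comp_apply,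
    ← exteriorPower.map_comp, splitMap_comp h']

end Modules

/-! ### The chain complex of a graph

`G` is a finite multigraph (loops and parallel edges allowed), with a total order
`e₁ < ⋯ < eₘ` on its edges. -/

section Complex

variable {α β : Type*} (G : Graph α β)

/-- The partition of the vertices into the connected components of the spanning subgraph with
edge set `F`. -/
def components (F : Finset E(G)) : Setoid V(G) :=
  Relation.EqvGen.setoid fun x y => ∃ e ∈ F, G.IsLink e x y

lemma components_mono {F F' : Finset E(G)} (h : F' ⊆ F) : components G F' ≤ components G F :=
  Setoid.eqvGen_mono fun _ _ ⟨e, he, hl⟩ => ⟨e, h he, hl⟩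

/-- The states (spanning subgraphs) of `G` with `i` edges. -/
abbrev State (i : ℕ) : Type _ := {F : Finset E(G) // F.card = i}

variable [LinearOrder E(G)]

/-- Removing an edge from a state. -/
def State.erase {G : Graph α β} [LinearOrder E(G)] {i : ℕ} (F : State G (i + 1)) (e : E(G))
    (he : e ∈ F.1) : State G i :=
  ⟨F.1.erase e, by rw [Finset.card_erase_of_mem he, F.2, Nat.add_sub_cancel]⟩

lemma components_erase_le {i : ℕ} (F : State G (i + 1)) {e : E(G)} (he : e ∈ F.1) :
    components G (F.erase e he).1 ≤ components G F.1 :=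
  components_mono G (F.1.erase_subset e)

/-- The sign of the per-edge map `M_F → M_{F-e}`: `(-1)^k`, where `k` is the number of edges of
`F` that come after `e`. -/
def edgeSign (F : Finset E(G)) (e : E(G)) : ℤ := (-1) ^ (F.filter fun e' => e < e').card

lemma edgeSign_erase_of_lt {F : Finset E(G)} {a b : E(G)} (hb : b ∈ F) (h : a < b) :
    edgeSign G F a = -edgeSign G (F.erase b) a := by
  have h1 : b ∈ F.filter fun e' => a < e' := Finset.mem_filter.mpr ⟨hb, h⟩
  rw [edgeSign, edgeSign, Finset.filter_erase, ← Finset.card_erase_add_one h1, pow_succ]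
  ring

lemma edgeSign_erase_of_gt {F : Finset E(G)} {a b : E(G)} (h : a < b) :
    edgeSign G (F.erase a) b = edgeSign G F b := by
  rw [edgeSign, edgeSign, Finset.filter_erase, Finset.erase_eq_of_notMem]
  simp [h.le]

/-- Every square of the Boolean lattice of states has an odd number of negative signs. -/
lemma edgeSign_square {F : Finset E(G)} {a b : E(G)} (ha : a ∈ F) (hb : b ∈ F) (h : a ≠ b) :
    edgeSign G F a * edgeSign G (F.erase a) b + edgeSign G F b * edgeSign G (F.erase b) a = 0 := by
  rcases lt_or_gt_of_ne h with h | h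
  · rw [edgeSign_erase_of_lt G hb h, edgeSign_erase_of_gt G h]
    ring
  · rw [edgeSign_erase_of_lt G ha h, edgeSign_erase_of_gt G h]
    ring

variable [Fintype V(G)]

/-- The space underlying `chainRep`. -/
abbrev ChainModule (i j : ℕ) : Type _ :=
  DirectSum (State G i) fun F => PartModule (components G F.1) j

/-- The `𝔖_{V(G)}`-module `C_{i,j}(G) = ⨁_{|F| = i} (M_F)_j`. -/
def chainRep (i j : ℕ) : Representation ℂ (Equiv.Perm V(G)) (ChainModule G i j) :=
  Representation.directSum fun F : State G i => partRep (components G F.1) j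

/-- The linear map underlying `differential`. -/
def differentialAux (i j : ℕ) :
    ChainModule G (i + 1) j →ₗ[ℂ] ChainModule G i j :=
  DirectSum.toModule ℂ _ _ fun F => ∑ e : F.1,
    edgeSign G F.1 e •
      (DirectSum.lof ℂ (State G i) (fun F => PartModule (components G F.1) j) (F.erase e e.2)).comp
        (perEdge (components_erase_le G F e.2) j).toLinearMap

lemma differentialAux_lof (i j : ℕ) (F : State G (i + 1)) (x : PartModule (components G F.1) j) :
    differentialAux G i j
        (DirectSum.lof ℂ (State G (i + 1)) (fun F => PartModule (components G F.1) j) F x) =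
      ∑ e : F.1, edgeSign G F.1 e •
        DirectSum.lof ℂ (State G i) (fun F => PartModule (components G F.1) j) (F.erase e e.2)
          (perEdge (components_erase_le G F e.2) j x) := by
  rw [differentialAux, DirectSum.toModule_lof, LinearMap.sum_apply]
  rfl

lemma chainRep_lof (i j : ℕ) (g : Equiv.Perm V(G)) (F : State G i)
    (x : PartModule (components G F.1) j) :
    chainRep G i j g
        (DirectSum.lof ℂ (State G i) (fun F => PartModule (components G F.1) j) F x) =
      DirectSum.lof ℂ (State G i) (fun F => PartModule (components G F.1) j) F
        (partRep (components G F.1) j g x) := by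
  rw [chainRep, Representation.directSum_apply, DirectSum.lmap_lof]

lemma differentialAux_chainRep (i j : ℕ) (g : Equiv.Perm V(G)) (x : ChainModule G (i + 1) j) :
    differentialAux G i j (chainRep G (i + 1) j g x) =
      chainRep G i j g (differentialAux G i j x) := by
  suffices h : differentialAux G i j ∘ₗ chainRep G (i + 1) j g =
      chainRep G i j g ∘ₗ differentialAux G i j from LinearMap.congr_fun h x
  refine DirectSum.linearMap_ext ℂ fun F => LinearMap.ext fun y => ?_
  simp only [LinearMap.comp_apply]
  rw [chainRep_lof, differentialAux_lof, differentialAux_lof, map_sum]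
  refine Finset.sum_congr rfl fun e _ => ?_
  rw [map_zsmul, chainRep_lof, Representation.IntertwiningMap.isIntertwining]

/-- The differential `d_{i+1,j} : C_{i+1,j}(G) → C_{i,j}(G)`, the sum of the signed per-edge maps
`M_F → M_{F-e}` over all states `F` with `i + 1` edges and all `e ∈ F`. -/
def differential (i j : ℕ) : (chainRep G (i + 1) j).IntertwiningMap (chainRep G i j) :=
  LinearMap.intertwiningMap_of_isIntertwiningMap _ _ (differentialAux G i j)
    (differentialAux_chainRep G i j)

lemma lof_perEdge_congr {i j : ℕ} {s : Setoid V(G)} (x : PartModule s j) {F F' : State G i}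
    (h : F = F') (hF : components G F.1 ≤ s) (hF' : components G F'.1 ≤ s) :
    DirectSum.lof ℂ (State G i) (fun F => PartModule (components G F.1) j) F (perEdge hF j x) =
      DirectSum.lof ℂ (State G i) (fun F => PartModule (components G F.1) j) F'
        (perEdge hF' j x) := by
  subst h
  rfl

theorem differential_comp_differential (i j : ℕ)
    (x : ChainModule G (i + 2) j) :
    differential G i j (differential G (i + 1) j x) = 0 := by
  suffices h : differentialAux G i j ∘ₗ differentialAux G (i + 1) j = 0 from
    LinearMap.congr_fun h x
  refine DirectSum.linearMap_ext ℂ fun F => LinearMap.ext fun y => ?_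
  simp only [LinearMap.comp_apply, LinearMap.zero_apply]
  rw [differentialAux_lof, map_sum]
  simp only [map_zsmul, differentialAux_lof, Finset.smul_sum, smul_smul, perEdge_comp]
  rw [Finset.sum_sigma']
  refine Finset.sum_involution
    (fun p _ => ⟨⟨p.2.1, Finset.mem_of_mem_erase p.2.2⟩, ⟨p.1.1, Finset.mem_erase.mpr
      ⟨(Finset.ne_of_mem_erase p.2.2).symm, p.1.2⟩⟩⟩) ?_ ?_ (fun _ _ => by simp) (fun _ _ => rfl)
  · rintro ⟨⟨a, ha⟩, ⟨b, hb⟩⟩ -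
    have hb' : b ∈ F.1 := Finset.mem_of_mem_erase hb
    have hab : b ≠ a := Finset.ne_of_mem_erase hb
    have e1 : (F.erase a ha).erase b hb =
        (F.erase b hb').erase a (Finset.mem_erase.mpr ⟨hab.symm, ha⟩) :=
      Subtype.ext (Finset.erase_right_comm)
    have e2 := edgeSign_square G ha hb' hab.symm
    dsimp only
    rw [lof_perEdge_congr G y e1 _ ((components_mono G (Finset.erase_subset _ _)).trans
      (components_mono G (Finset.erase_subset _ _))), ← add_smul]
    exact (congrArg (fun z : ℤ => z • _) e2).trans (zero_smul ℤ _)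
  · rintro ⟨⟨a, ha⟩, ⟨b, hb⟩⟩ - - h
    have hab : b ≠ a := Finset.ne_of_mem_erase hb
    simp only [Sigma.mk.injEq, Subtype.mk.injEq] at h
    exact hab h.1

/-- The cycles `ker d_{i,j}`, where `d_{0,j} = 0`. -/
def cycles : (i j : ℕ) → Subrepresentation (chainRep G i j)
  | 0, _ => ⊤
  | i + 1, j => (differential G i j).ker

/-- The boundaries `im d_{i+1,j}`. -/
def boundaries (i j : ℕ) : Subrepresentation (chainRep G i j) := (differential G i j).range

theorem boundaries_le_cycles (i j : ℕ) : boundaries G i j ≤ cycles G i j := by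
  cases i with
  | zero => exact le_top
  | succ i =>
    rintro _ ⟨x, rfl⟩
    exact differential_comp_differential G i j x

/-- The homology `H_{i,j}(G) = ker d_{i,j} / im d_{i+1,j}`, as a representation of `𝔖_{V(G)}`. -/
def homologyRep (i j : ℕ) :
    Representation ℂ (Equiv.Perm V(G))
      ((cycles G i j).toSubmodule ⧸
        (boundaries G i j).toSubmodule.submoduleOf (cycles G i j).toSubmodule) :=
  (cycles G i j).toRepresentation.quotient _
    (fun g _ hx => (boundaries G i j).apply_mem_toSubmodule g hx)

end Complex

/-! ### Symmetric functions

Symmetric functions are formal power series with complex coefficients in variables indexed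
by `ℕ`. -/

/-- The power sum `p_k = ∑ᵢ xᵢ^k` (for `k ≥ 1`): the coefficient of each monomial `xᵢ^k` is `1`,
all others vanish. -/
def powerSum (k : ℕ) : MvPowerSeries ℕ ℂ := by
  classical exact fun m => if ∃ i, m = Finsupp.single i k then 1 else 0

/-- The Frobenius characteristic of a finite-dimensional representation of `𝔖_V`, `n = |V|`:
`ch ρ = (1/n!) ∑_{σ ∈ 𝔖_V} χ_ρ(σ) p_{λ(σ)} = ∑_{μ ⊢ n} χ_ρ(μ) z_μ⁻¹ p_μ`, where `λ(σ)` is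
the cycle type of `σ` (fixed points included). -/
def frobChar {V W : Type*} [Fintype V] [DecidableEq V] [AddCommGroup W] [Module ℂ W]
    (ρ : Representation ℂ (Equiv.Perm V) W) : MvPowerSeries ℕ ℂ :=
  ((Fintype.card V).factorial : ℂ)⁻¹ •
    ∑ σ : Equiv.Perm V, ρ.character σ • (σ.partition.parts.map powerSum).prod

/-- The bigraded Frobenius series `Frob_G(q,t) = ∑_{i,j} (-1)^{i+j} t^i q^j ch H_{i,j}(G)`.
The terms with `i > |E(G)|` or `j > |V(G)|` vanish, as `C_{i,j}(G) = 0` there. -/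
def frobeniusSeries {α β : Type*} (G : Graph α β) [Fintype V(G)] [DecidableEq V(G)]
    [Fintype E(G)] [LinearOrder E(G)] (q t : ℂ) : MvPowerSeries ℕ ℂ :=
  ∑ i ∈ Finset.range (Fintype.card E(G) + 1), ∑ j ∈ Finset.range (Fintype.card V(G) + 1),
    ((-1) ^ (i + j) * t ^ i * q ^ j) • frobChar (homologyRep G i j)

/-- Proper colourings with colours in `ℕ`: the ends of every edge get different colours
(so there are none if `G` has a loop). -/
def IsProperColouring {α β : Type*} (G : Graph α β) (κ : V(G) → ℕ) : Prop :=
  ∀ (e : β) (x y : V(G)), G.IsLink e x y → κ x ≠ κ y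

/-- The chromatic symmetric function `X_G = ∑_κ ∏_v x_{κ(v)}`, the sum being over all proper
colourings `κ : V(G) → ℕ`: the coefficient of a monomial is the number of proper colourings `κ`
with `∏_v x_{κ(v)}` equal to it. -/
def chromaticSymmetricFunction {α β : Type*} (G : Graph α β) [Fintype V(G)] :
    MvPowerSeries ℕ ℂ :=
  fun m => (Set.ncard {κ : V(G) → ℕ | IsProperColouring G κ ∧
    ∑ v, Finsupp.single (κ v) 1 = m} : ℂ)

end ChromaticHomology

end

/-! At `q = t = 1` the series is an Euler characteristic, so homology may be replaced by chains: the
differential enters only through equivariance and `d² = 0`. This leaves the sum over `F` of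
`(-1)^|F|` times the alternating sum over `j` of `ch (M_F)_j`, which is compared with `X_G` one
monomial at a time.

The coefficient of a monomial in the power sum of `σ` counts the colourings with that monomial that
`σ` preserves (`coeff_prod_powerSum`). Frobenius reciprocity (`sum_coind_character_mul`) turns `ch
(M_F)_j` into an average over the Young subgroup `Y`. Thus a colouring `κ` contributes the average
over `Y`, supported on the `g` preserving `κ`, of `∑ (-1)^j tr Λʲ(g) = det(1 - g)` on
`reducedSpace`. If `κ` is not constant on some block, all these `g` fix a common nonzero vector and
the determinant vanishes. If `κ` is constant on blocks, the average runs over all of `Y` and counts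
invariants of `Λʲ`, namely one dimension for `j = 0` and none for `j > 0` (`sum_extRep_succ`).

Each `F` therefore counts the colourings constant on its components (`alternating_sum_partRep`), and
inclusion-exclusion over `F` leaves the proper ones (`sum_const_on_components`). -/

noncomputable section

namespace ChromaticHomology

/-! ### Traces, exact sequences and decompositions of the identity. -/

section LinearAlgebra

variable {k M N Q : Type*} [Field k] [AddCommGroup M] [Module k M] [AddCommGroup N] [Module k N]
  [AddCommGroup Q] [Module k Q]

/-- The trace is additive along short exact sequences. -/
lemma trace_eq_add_of_exact [FiniteDimensional k M] [FiniteDimensional k N]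
    [FiniteDimensional k Q] {i : N →ₗ[k] M} {p : M →ₗ[k] Q} (hi : Function.Injective i)
    (hp : Function.Surjective p) (hex : Function.Exact i p)
    {f : M →ₗ[k] M} {f₁ : N →ₗ[k] N} {f₂ : Q →ₗ[k] Q}
    (h₁ : f ∘ₗ i = i ∘ₗ f₁) (h₂ : p ∘ₗ f = f₂ ∘ₗ p) :
    LinearMap.trace k M f = LinearMap.trace k N f₁ + LinearMap.trace k Q f₂ := by
  obtain ⟨s, hs⟩ := p.exists_rightInverse_of_surjective (LinearMap.range_eq_top.mpr hp)
  obtain ⟨r₀, hr₀⟩ := i.exists_leftInverse_of_injective (LinearMap.ker_eq_bot.mpr hi)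
  have hs' : ∀ x, p (s x) = x := LinearMap.congr_fun hs
  have hr' : ∀ x, r₀ (i x) = x := LinearMap.congr_fun hr₀
  -- Since `id - s p` lands in the image of `i`, the map `r₀ (id - s p)` is the retraction
  -- complementary to `s`, and `M` splits as `N ⊕ Q`.
  have hid : i ∘ₗ (r₀ ∘ₗ (LinearMap.id - s ∘ₗ p)) + s ∘ₗ p = LinearMap.id := by
    ext x
    obtain ⟨y, hy⟩ := (hex (x - s (p x))).mp (by rw [map_sub, hs', sub_self])
    simp only [LinearMap.add_apply, LinearMap.comp_apply, LinearMap.sub_apply, LinearMap.id_apply]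
    rw [← hy, hr', hy, sub_add_cancel]
  have hri : (r₀ ∘ₗ (LinearMap.id - s ∘ₗ p)) ∘ₗ i = LinearMap.id := by
    ext x
    simp [hr', hex.apply_apply_eq_zero]
  calc LinearMap.trace k M f
      = LinearMap.trace k M (f ∘ₗ (i ∘ₗ (r₀ ∘ₗ (LinearMap.id - s ∘ₗ p)) + s ∘ₗ p)) := by
        rw [hid, LinearMap.comp_id]
    _ = LinearMap.trace k M (i ∘ₗ (f₁ ∘ₗ (r₀ ∘ₗ (LinearMap.id - s ∘ₗ p)))) +
        LinearMap.trace k M ((f ∘ₗ s) ∘ₗ p) := by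
        rw [LinearMap.comp_add, map_add, ← LinearMap.comp_assoc, h₁]; rfl
    _ = _ := by
        rw [LinearMap.trace_comp_comm' _ i, LinearMap.trace_comp_comm' p (f ∘ₗ s), LinearMap.comp_assoc,
          hri, LinearMap.comp_id, ← LinearMap.comp_assoc, h₂, LinearMap.comp_assoc, hs,
          LinearMap.comp_id]

/-- The trace of an endomorphism of a finite direct sum is the sum of the traces of its diagonal
blocks. -/
lemma trace_eq_sum_of_decomposition {I : Type*} [Fintype I] {A : I → Type*}
    [∀ i, AddCommGroup (A i)] [∀ i, Module k (A i)] [FiniteDimensional k M]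
    [∀ i, FiniteDimensional k (A i)] (ι : ∀ i, A i →ₗ[k] M) (π : ∀ i, M →ₗ[k] A i)
    (h : ∑ i, ι i ∘ₗ π i = LinearMap.id) (f : M →ₗ[k] M) :
    LinearMap.trace k M f = ∑ i, LinearMap.trace k (A i) (π i ∘ₗ f ∘ₗ ι i) := by
  have hf : f = ∑ i, f ∘ₗ ι i ∘ₗ π i := by
    ext x
    simpa using congrArg f (LinearMap.congr_fun h x).symm
  conv_lhs => rw [hf, map_sum]
  refine Finset.sum_congr rfl fun i _ => ?_
  rw [← LinearMap.comp_assoc, LinearMap.trace_comp_comm']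

end LinearAlgebra

/-! ### Exterior powers: contraction, wedge and the vanishing of `det(1 - g)`. -/

section Exterior

variable {k T : Type*} [Field k] [AddCommGroup T] [Module k T]

lemma contractLeft_mem_exteriorPower (d : Module.Dual k T) (j : ℕ) {x : ExteriorAlgebra k T}
    (hx : x ∈ ⋀[k]^(j + 1) T) : CliffordAlgebra.contractLeft d x ∈ ⋀[k]^j T := by
  induction j generalizing x with
  | zero =>
    rw [ExteriorAlgebra.exteriorPower, zero_add, pow_one] at hx
    obtain ⟨a, rfl⟩ := hx
    rw [ExteriorAlgebra.exteriorPower, pow_zero]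
    erw [CliffordAlgebra.contractLeft_ι]
    exact ⟨d a, (Algebra.algebraMap_eq_smul_one _).symm⟩
  | succ j ih =>
    rw [ExteriorAlgebra.exteriorPower, pow_succ'] at hx
    induction hx using Submodule.mul_induction_on' with
    | mem_mul_mem a ha b hb =>
      obtain ⟨a, rfl⟩ := ha
      erw [CliffordAlgebra.contractLeft_ι_mul]
      refine Submodule.sub_mem _ (Submodule.smul_mem _ _ hb) ?_
      rw [ExteriorAlgebra.exteriorPower, pow_succ']
      exact Submodule.mul_mem_mul ⟨a, rfl⟩ (ih hb)
    | add a _ b _ ha hb => rw [map_add]; exact Submodule.add_mem _ ha hb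

/-- Exterior multiplication by a vector on the left. -/
def wedgeLeft (v : T) (j : ℕ) : ⋀[k]^j T →ₗ[k] ⋀[k]^(j + 1) T :=
  (LinearMap.mulLeft k (ExteriorAlgebra.ι k v)).restrict fun x hx => by
    rw [ExteriorAlgebra.exteriorPower, pow_succ']
    exact Submodule.mul_mem_mul ⟨v, rfl⟩ hx

/-- Contraction of exterior powers with a linear form. -/
def contract (d : Module.Dual k T) (j : ℕ) : ⋀[k]^(j + 1) T →ₗ[k] ⋀[k]^j T :=
  (CliffordAlgebra.contractLeft d).restrict fun _ hx => contractLeft_mem_exteriorPower d j hx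

/-- Contraction is an antiderivation, so wedging with `v` is a contracting homotopy for the Koszul
complex of `d`. -/
lemma contract_wedgeLeft_add (d : Module.Dual k T) (v : T) (h : d v = 1) (j : ℕ) :
    contract d (j + 1) ∘ₗ wedgeLeft v (j + 1) + wedgeLeft v j ∘ₗ contract d j =
      LinearMap.id := by
  refine LinearMap.ext fun x => Subtype.ext ?_
  change CliffordAlgebra.contractLeft d (CliffordAlgebra.ι _ v * x.1) +
    CliffordAlgebra.ι _ v * CliffordAlgebra.contractLeft d x.1 = x.1
  rw [CliffordAlgebra.contractLeft_ι_mul, h, one_smul, sub_add_cancel]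

lemma contract_wedgeLeft_zero (d : Module.Dual k T) (v : T) (h : d v = 1) :
    contract d 0 ∘ₗ wedgeLeft v 0 = LinearMap.id := by
  refine LinearMap.ext fun x => Subtype.ext ?_
  obtain ⟨c, hc⟩ := x.2
  change CliffordAlgebra.contractLeft d (CliffordAlgebra.ι _ v * x.1) = x.1
  have : CliffordAlgebra.contractLeft d x.1 = 0 := by
    rw [← hc, LinearMap.toSpanSingleton_apply, ← Algebra.algebraMap_eq_smul_one]
    exact CliffordAlgebra.contractLeft_algebraMap _ d c
  rw [CliffordAlgebra.contractLeft_ι_mul, h, one_smul, this, mul_zero, sub_zero]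

lemma map_wedgeLeft (g : T →ₗ[k] T) (v : T) (j : ℕ) :
    exteriorPower.map (j + 1) g ∘ₗ wedgeLeft v j =
      wedgeLeft (g v) j ∘ₗ exteriorPower.map j g := by
  refine exteriorPower.linearMap_ext (AlternatingMap.ext fun m => ?_)
  have h : ∀ (v : T) (m : Fin j → T), wedgeLeft v j (exteriorPower.ιMulti k j m) =
      exteriorPower.ιMulti k (j + 1) (Matrix.vecCons v m) := fun v m => Subtype.ext (by
    simp only [exteriorPower.ιMulti_apply_coe, ExteriorAlgebra.ιMulti_succ_apply]
    rfl)
  simp only [LinearMap.compAlternatingMap_apply, LinearMap.comp_apply]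
  rw [h, exteriorPower.map_apply_ιMulti, exteriorPower.map_apply_ιMulti, h]
  congr 1
  ext i
  refine Fin.cases ?_ (fun i => ?_) i <;> simp

/-- The alternating sum of the traces on the exterior powers vanishes for an endomorphism that
fixes a nonzero vector. -/
lemma alternating_sum_trace_exteriorPower_eq_zero [FiniteDimensional k T] (g : T →ₗ[k] T) {v : T}
    (hv : v ≠ 0) (hg : g v = v) {N : ℕ} (hN : Module.finrank k T ≤ N) :
    ∑ j ∈ Finset.range (N + 1), (-1 : k) ^ j *
      LinearMap.trace k (⋀[k]^j T) (exteriorPower.map j g) = 0 := by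
  obtain ⟨d, hd⟩ : ∃ d : Module.Dual k T, d v = 1 := by
    obtain ⟨d, hd⟩ := Module.Projective.exists_dual_ne_zero k hv
    exact ⟨(d v)⁻¹ • d, by simp [hd]⟩
  -- The sum telescopes: the homotopy identity splits each trace into two terms, and by cyclicity
  -- and `g v = v` (`comm`) one of them cancels the remainder from the degree below.
  have step : ∀ n, ∑ j ∈ Finset.range (n + 1), (-1 : k) ^ j *
      LinearMap.trace k (⋀[k]^j T) (exteriorPower.map j g) =
      (-1) ^ n * LinearMap.trace k _
        (exteriorPower.map (n + 1) g ∘ₗ wedgeLeft v n ∘ₗ contract d n) := by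
    have comm : ∀ n, LinearMap.trace k _
        (exteriorPower.map n g ∘ₗ contract d n ∘ₗ wedgeLeft v n) = LinearMap.trace k _
        (exteriorPower.map (n + 1) g ∘ₗ wedgeLeft v n ∘ₗ contract d n) := fun n => by
      rw [← LinearMap.comp_assoc, LinearMap.trace_comp_comm', ← LinearMap.comp_assoc,
        ← LinearMap.comp_assoc, map_wedgeLeft, hg]
    intro n
    induction n with
    | zero =>
      rw [← comm, contract_wedgeLeft_zero d v hd]
      simp
    | succ n ih =>
      rw [Finset.sum_range_succ, ih, ← comm (n + 1)]
      have h := congrArg (fun f => LinearMap.trace k _ (exteriorPower.map (n + 1) g ∘ₗ f))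
        (contract_wedgeLeft_add d v hd n)
      simp only [LinearMap.comp_add, map_add, LinearMap.comp_id] at h
      rw [← h, pow_succ]
      ring
  rw [step]
  -- The remaining term lives on `Λ^(N+1)`, which is zero because `N + 1` exceeds the dimension.
  have : Subsingleton (⋀[k]^(N + 1) T) := by
    rw [← Module.finrank_zero_iff (R := k), exteriorPower.finrank_eq,
      Nat.choose_eq_zero_of_lt (by omega)]
  rw [Subsingleton.elim (exteriorPower.map (N + 1) g ∘ₗ wedgeLeft v N ∘ₗ contract d N) 0, map_zero,
    mul_zero]

end Exterior

/-! ### Cycle type and orbits of a permutation. -/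

section CycleType

open Equiv.Perm

open Classical in
/-- A product over the parts of the cycle type, fixed points included, is a product over the
orbits. -/
lemma prod_map_parts_partition {V R : Type*} [Fintype V] [DecidableEq V] [CommMonoid R]
    (σ : Equiv.Perm V) [Fintype (Quotient (SameCycle.setoid σ))] (f : ℕ → R) :
    (σ.partition.parts.map f).prod = ∏ q : Quotient (SameCycle.setoid σ),
      f (Finset.card {v | Quotient.mk (SameCycle.setoid σ) v = q}) := by
  classical
  have hq : ∀ q v, Quotient.mk (SameCycle.setoid σ) v = q ↔ σ.SameCycle q.out v := fun q v => by
    conv_lhs => rw [← q.out_eq, eq_comm, Quotient.eq]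
    rfl
  have hfix : ∀ q : Quotient (SameCycle.setoid σ), q.out ∉ σ.support →
      Finset.filter (fun v => Quotient.mk (SameCycle.setoid σ) v = q) Finset.univ = {q.out} := by
    intro q h
    ext v
    rw [notMem_support] at h
    simp only [Finset.mem_filter, Finset.mem_univ, true_and, Finset.mem_singleton, hq]
    exact ⟨fun hv => (hv.eq_of_left h).symm, fun hv => hv ▸ SameCycle.refl _ _⟩
  -- Orbits are split by whether their representative is moved: moved ones correspond to the cycle
  -- factors, the others to the parts equal to 1.
  rw [parts_partition, Multiset.map_add, Multiset.prod_add, Multiset.map_replicate,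
    Multiset.prod_replicate, cycleType_def, Multiset.map_map,
    ← Finset.prod_filter_mul_prod_filter_not Finset.univ (fun q => q.out ∈ σ.support)]
  congr 1
  · symm
    refine Finset.prod_bij (fun q _ => σ.cycleOf q.out) ?_ ?_ ?_ ?_
    · intro q h
      rw [cycleOf_mem_cycleFactorsFinset_iff]
      exact (Finset.mem_filter.mp h).2
    · intro q h q' h' e
      rw [← sameCycle_iff_cycleOf_eq_of_mem_support (Finset.mem_filter.mp h).2
        (Finset.mem_filter.mp h').2] at e
      exact Quotient.out_equiv_out.mp e
    · intro c hc
      obtain ⟨x, hx⟩ := (mem_cycleFactorsFinset_iff.mp hc).1.nonempty_support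
      have hxσ : x ∈ σ.support := mem_cycleFactorsFinset_support_le hc hx
      have hs : σ.SameCycle (Quotient.mk (SameCycle.setoid σ) x).out x := (hq _ _).mp rfl
      refine ⟨Quotient.mk _ x, Finset.mem_filter.mpr ⟨Finset.mem_univ _, ?_⟩, ?_⟩
      · rw [mem_support] at hxσ ⊢
        exact fun h => hxσ ((hs.apply_eq_self_iff).mp h)
      · rw [cycle_is_cycleOf hx hc]
        exact hs.cycleOf_eq
    · intro q h
      simp only [Function.comp_apply]
      congr 2
      ext v
      simp only [Finset.mem_filter, Finset.mem_univ, true_and, hq]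
      rw [mem_support_cycleOf_iff]
      exact ⟨fun hv => ⟨hv, (Finset.mem_filter.mp h).2⟩, fun hv => hv.1⟩
  · rw [Finset.prod_congr rfl (g := fun _ => f 1), Finset.prod_const]
    · congr 1
      rw [← Finset.card_compl]
      symm
      refine Finset.card_bij (fun q _ => q.out) ?_ ?_ ?_
      · intro q h
        exact Finset.mem_compl.mpr (Finset.mem_filter.mp h).2
      · intro q _ q' _ e
        exact Quotient.out_injective e
      · intro x hx
        rw [Finset.mem_compl, notMem_support] at hx
        have hs : σ.SameCycle (Quotient.mk (SameCycle.setoid σ) x).out x := (hq _ _).mp rfl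
        have : (Quotient.mk (SameCycle.setoid σ) x).out = x := hs.eq_of_right hx
        refine ⟨Quotient.mk _ x, Finset.mem_filter.mpr ⟨Finset.mem_univ _, ?_⟩, this⟩
        rw [this, notMem_support]
        exact hx
    · intro q h
      rw [hfix q (Finset.mem_filter.mp h).2, Finset.card_singleton]

end CycleType

/-! ### Power sums as generating functions of invariant colourings. -/

section Colourings

variable {V : Type*} [Fintype V] [DecidableEq V]

/-- The colourings `κ` with `∏ᵥ x_{κ(v)}` equal to a given monomial. -/
def colourings (V : Type*) [Fintype V] [DecidableEq V] (m : ℕ →₀ ℕ) : Finset (V → ℕ) :=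
  (Fintype.piFinset fun _ => m.support).filter fun κ => ∑ v, Finsupp.single (κ v) 1 = m

/-- Confining the values to `m.support` only secures finiteness: every colour used occurs in the
monomial. -/
lemma mem_colourings {m : ℕ →₀ ℕ} {κ : V → ℕ} :
    κ ∈ colourings V m ↔ ∑ v, Finsupp.single (κ v) 1 = m := by
  rw [colourings, Finset.mem_filter, and_iff_right_iff_imp, Fintype.mem_piFinset]
  rintro rfl v
  rw [Finsupp.mem_support_iff, Finsupp.finsetSum_apply]
  refine (Nat.pos_of_ne_zero ?_).ne'
  intro h
  have := Finset.sum_eq_zero_iff.mp h v (Finset.mem_univ v)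
  simp at this

/-- The coefficients of the power sum `p_{λ(σ)}` count the colourings that are constant on the
cycles of `σ`. -/
lemma coeff_prod_powerSum (σ : Equiv.Perm V) (m : ℕ →₀ ℕ) :
    MvPowerSeries.coeff m (σ.partition.parts.map powerSum).prod =
      (((colourings V m).filter fun κ => ∀ v, κ (σ v) = κ v).card : ℂ) := by
  classical
  have : Fintype (Quotient (Equiv.Perm.SameCycle.setoid σ)) := Fintype.ofFinite _
  let S := Equiv.Perm.SameCycle.setoid σ
  let b : Quotient S → ℕ := fun q => Finset.card {v | Quotient.mk S v = q}
  have hb : ∀ v, b (Quotient.mk S v) ≠ 0 := fun v =>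
    Finset.card_ne_zero_of_mem (a := v) (by simp)
  -- `L κ` records the monomial contributed by each orbit. On invariant colourings it is the
  -- bijection with the choices of one term `x_i^b` from each factor `p_b` of the product.
  let L : (V → ℕ) → (Quotient S →₀ (ℕ →₀ ℕ)) := fun κ =>
    ∑ v, Finsupp.single (Quotient.mk S v) (Finsupp.single (κ v) 1)
  have hL : ∀ (κ : V → ℕ) (c : Quotient S → ℕ), (∀ v, κ v = c (Quotient.mk S v)) →
      ∀ q, L κ q = Finsupp.single (c q) (b q) := by
    intro κ c hκ q
    have h1 : ∀ v, (Finsupp.single (Quotient.mk S v) (Finsupp.single (κ v) 1) :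
        Quotient S →₀ (ℕ →₀ ℕ)) q =
        if Quotient.mk S v = q then Finsupp.single (c q) 1 else 0 := fun v => by
      rw [Finsupp.single_apply]
      split_ifs with h
      · rw [hκ, h]
      · rfl
    rw [Finsupp.finsetSum_apply, Finset.sum_congr rfl fun v _ => h1 v, ← Finset.sum_filter,
      Finset.sum_const, Finsupp.smul_single, smul_eq_mul, mul_one]
  have hconst : ∀ κ : V → ℕ, (∀ v, κ (σ v) = κ v) → ∃ c : Quotient S → ℕ,
      ∀ v, κ v = c (Quotient.mk S v) := by
    intro κ hκ
    refine ⟨Quotient.lift κ ?_, fun v => rfl⟩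
    intro x y (h : σ.SameCycle x y)
    obtain ⟨i, rfl⟩ := h.exists_nat_pow_eq
    clear h
    induction i with
    | zero => rfl
    | succ i ih => rw [pow_succ', Equiv.Perm.mul_apply, hκ, ← ih]
  have hcoef : ∀ (k : ℕ) (m : ℕ →₀ ℕ), MvPowerSeries.coeff m (powerSum k) =
      if ∃ i, m = Finsupp.single i k then (1 : ℂ) else 0 := fun k m => by
    change powerSum k m = _
    unfold powerSum
    congr
  rw [prod_map_parts_partition, MvPowerSeries.coeff_prod]
  simp only [hcoef]
  simp only [Finset.prod_boole, Finset.mem_univ, true_imp_iff, Finset.sum_boole]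
  norm_cast
  symm
  refine Finset.card_bij (fun κ _ => L κ) ?_ ?_ ?_
  · intro κ hκ
    rw [Finset.mem_filter, mem_colourings] at hκ
    obtain ⟨c, hc⟩ := hconst κ hκ.2
    rw [Finset.mem_filter, Finset.mem_finsuppAntidiag]
    refine ⟨⟨?_, Finset.subset_univ _⟩, fun q => ⟨c q, hL κ c hc q⟩⟩
    rw [← hκ.1]
    simp only [L, Finsupp.finsetSum_apply]
    rw [Finset.sum_comm]
    refine Finset.sum_congr rfl fun v _ => ?_
    simp [Finsupp.single_apply]
  · intro κ hκ κ' hκ' h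
    obtain ⟨c, hc⟩ := hconst κ (Finset.mem_filter.mp hκ).2
    obtain ⟨c', hc'⟩ := hconst κ' (Finset.mem_filter.mp hκ').2
    funext v
    have h1 := DFunLike.congr_fun h (Quotient.mk S v)
    rw [hL κ c hc, hL κ' c' hc'] at h1
    rw [hc, hc']
    -- The colour can be read off from `x_i^b` because orbits are nonempty, so `b ≠ 0`.
    exact Finsupp.single_left_injective (hb v) h1
  · intro l hl
    rw [Finset.mem_filter, Finset.mem_finsuppAntidiag] at hl
    obtain ⟨⟨hsum, -⟩, hl⟩ := hl
    choose c hc using hl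
    have hLl : L (fun v => c (Quotient.mk S v)) = l :=
      Finsupp.ext fun q => (hL _ c (fun _ => rfl) q).trans (hc q).symm
    refine ⟨fun v => c (Quotient.mk S v), ?_, hLl⟩
    rw [Finset.mem_filter, mem_colourings]
    refine ⟨?_, fun v => ?_⟩
    · rw [← hsum, ← hLl]
      simp only [L, Finsupp.finsetSum_apply]
      rw [Finset.sum_comm]
      refine Finset.sum_congr rfl fun v _ => ?_
      simp [Finsupp.single_apply]
    · exact congrArg c (Quotient.sound (s := S) <|
        Equiv.Perm.sameCycle_apply_left.mpr (Equiv.Perm.SameCycle.refl σ v))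

end Colourings

/-! ### Characters of coinduced representations and Frobenius reciprocity. -/

section Coinduced

variable {k G A : Type*} [Field k] [Group G] [AddCommGroup A] [Module k A]

/-- The average of a function over the cosets of a finite subgroup, an equivariant function. -/
def coindAverage (H : Subgroup G) [Fintype H] (ρ : Representation k H A) :
    (G → A) →ₗ[k] Representation.coindV H.subtype ρ :=
  LinearMap.codRestrict _
    (LinearMap.pi fun x => (Fintype.card H : k)⁻¹ • ∑ y : H, ρ y⁻¹ ∘ₗ LinearMap.proj (↑y * x))
    fun f h x => by
      simp only [LinearMap.pi_apply, LinearMap.smul_apply, LinearMap.sum_apply,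
        LinearMap.comp_apply, LinearMap.proj_apply, map_smul, map_sum]
      congr 1
      refine Fintype.sum_equiv (Equiv.mulRight h) _ _ fun y => ?_
      rw [← Module.End.mul_apply, ← map_mul]
      simp [mul_assoc]

lemma coindAverage_apply (H : Subgroup G) [Fintype H] (ρ : Representation k H A) (f : G → A)
    (x : G) : (coindAverage H ρ f).1 x = (Fintype.card H : k)⁻¹ • ∑ y : H, ρ y⁻¹ (f (y * x)) := by
  change ((Fintype.card H : k)⁻¹ • ∑ y : H, ρ y⁻¹ ∘ₗ LinearMap.proj (↑y * x)) f = _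
  rw [LinearMap.smul_apply, LinearMap.sum_apply]
  rfl

/-- By equivariance all terms of the average agree, so averaging is a projection onto the coinduced
space; this needs `|H|` invertible. -/
lemma coindAverage_coe [CharZero k] (H : Subgroup G) [Fintype H] (ρ : Representation k H A)
    (f : Representation.coindV H.subtype ρ) : coindAverage H ρ f.1 = f := by
  refine Subtype.ext (funext fun x => ?_)
  have h : ∀ y : H, ρ y⁻¹ (f.1 (y * x)) = f.1 x := fun y => by
    have := f.2 y x
    rw [Subgroup.subtype_apply] at this
    rw [this, ← Module.End.mul_apply, ← map_mul, inv_mul_cancel, map_one, Module.End.one_apply]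
  rw [coindAverage_apply, Finset.sum_congr rfl fun y _ => h y, Finset.sum_const, Finset.card_univ,
    ← Nat.cast_smul_eq_nsmul k, smul_smul, inv_mul_cancel₀ (by simp), one_smul]

open Classical in
/-- The character of a coinduced representation of a finite group. -/
lemma coind_character [CharZero k] [FiniteDimensional k A] [Fintype G] (H : Subgroup G) [Fintype H]
    (ρ : Representation k H A) (g : G) :
    (Representation.coind H.subtype ρ).character g = (Fintype.card H : k)⁻¹ *
      ∑ x : G, ∑ y : H, if x * g = y * x then ρ.character y else 0 := by
  -- Factoring the identity through one copy of `A` for each `x : G` gives the trace without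
  -- choosing coset representatives; the redundancy is absorbed by `|H|⁻¹`.
  have hdec : ∑ x : G, (coindAverage H ρ ∘ₗ LinearMap.single k (fun _ : G => A) x) ∘ₗ
      (LinearMap.proj x ∘ₗ (Representation.coindV H.subtype ρ).subtype) = LinearMap.id := by
    refine LinearMap.ext fun f => ?_
    rw [LinearMap.sum_apply]
    simp only [LinearMap.comp_apply, LinearMap.proj_apply, Submodule.subtype_apply,
      LinearMap.id_apply]
    rw [← map_sum]
    conv_rhs => rw [← coindAverage_coe H ρ f]
    congr 1
    exact Finset.univ_sum_single f.1
  rw [Representation.character, trace_eq_sum_of_decomposition _ _ hdec, Finset.mul_sum]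
  refine Finset.sum_congr rfl fun x _ => ?_
  have h : (LinearMap.proj x ∘ₗ (Representation.coindV H.subtype ρ).subtype) ∘ₗ
      Representation.coind H.subtype ρ g ∘ₗ
      coindAverage H ρ ∘ₗ LinearMap.single k (fun _ : G => A) x =
      (Fintype.card H : k)⁻¹ • ∑ y : H, if x * g = y * x then ρ y else 0 := by
    refine LinearMap.ext fun a => ?_
    change (coindAverage H ρ (Pi.single x a)).1 (x * g) = _
    rw [coindAverage_apply, LinearMap.smul_apply, LinearMap.sum_apply]
    congr 1
    refine Fintype.sum_equiv (Equiv.inv H) _ _ fun y => ?_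
    have hy : (y : G) * (x * g) = x ↔ x * g = (y⁻¹ : H) * x := by
      rw [Subgroup.coe_inv, eq_inv_mul_iff_mul_eq]
    by_cases hyx : (y : G) * (x * g) = x
    · rw [Equiv.inv_apply, if_pos (hy.mp hyx), hyx, Pi.single_eq_same]
    · rw [Equiv.inv_apply, if_neg (fun h => hyx (hy.mpr h)), Pi.single_eq_of_ne hyx, map_zero,
        LinearMap.zero_apply]
  rw [h, map_smul, map_sum, smul_eq_mul]
  congr 1
  refine Finset.sum_congr rfl fun y _ => ?_
  split_ifs
  · rfl
  · rw [map_zero]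

/-- Pairing of a coinduced character with a class function. -/
lemma sum_coind_character_mul [CharZero k] [FiniteDimensional k A] [Fintype G] (H : Subgroup G)
    [Fintype H] (ρ : Representation k H A) {P : G → k} (hP : ∀ x g, P (x * g * x⁻¹) = P g) :
    (Fintype.card G : k)⁻¹ * ∑ g, (Representation.coind H.subtype ρ).character g * P g =
      (Fintype.card H : k)⁻¹ * ∑ y : H, ρ.character y * P y := by
  classical
  -- For given `x` and `y` only the conjugate `g = x⁻¹ y x` contributes, and `P` takes the same
  -- value there as at `y`.
  have h : ∀ x : G, ∀ y : H, ∑ g, (if x * g = y * x then ρ.character y else 0) * P g =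
      ρ.character y * P y := fun x y => by
    rw [Finset.sum_eq_single (x⁻¹ * (y * x))]
    · have := hP x⁻¹ y
      rw [inv_inv, mul_assoc] at this
      rw [if_pos (mul_inv_cancel_left _ _), this]
    · intro g _ hg
      rw [if_neg (fun h => hg (eq_inv_mul_of_mul_eq h)), zero_mul]
    · simp
  have h' : ∑ g, (Representation.coind H.subtype ρ).character g * P g =
      (Fintype.card H : k)⁻¹ * ∑ x : G, ∑ y : H, ρ.character y * P y := by
    simp only [coind_character, mul_assoc]
    rw [← Finset.mul_sum]
    simp only [Finset.sum_mul]
    rw [Finset.sum_comm]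
    congr 1
    refine Finset.sum_congr rfl fun x _ => ?_
    rw [Finset.sum_comm]
    exact Finset.sum_congr rfl fun y _ => h x y
  rw [h', Finset.sum_const, Finset.card_univ, nsmul_eq_mul, mul_left_comm,
    inv_mul_cancel_left₀ (by simp)]

end Coinduced

/-! ### Wedge products under shears along a vector. -/

section Shear

variable {k T : Type*} [Field k] [AddCommGroup T] [Module k T]

/-- Multiples of `t` die next to a factor `t`, and anticommutation moves that factor past each entry
in turn. -/
lemma ι_mul_ιMulti_of_shear (t : T) {j : ℕ} (m m' : Fin j → T) (c : Fin j → k)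
    (h : ∀ i, m' i = m i + c i • t) :
    ExteriorAlgebra.ι k t * ExteriorAlgebra.ιMulti k j m' =
      ExteriorAlgebra.ι k t * ExteriorAlgebra.ιMulti k j m := by
  induction j with
  | zero => rw [Subsingleton.elim m' m]
  | succ j ih =>
    have ih := ih (Matrix.vecTail m) (Matrix.vecTail m') (Matrix.vecTail c) fun i => h i.succ
    have swap : ExteriorAlgebra.ι k t * ExteriorAlgebra.ι k (m 0) =
        -(ExteriorAlgebra.ι k (m 0) * ExteriorAlgebra.ι k t) :=
      eq_neg_of_add_eq_zero_left (ExteriorAlgebra.ι_add_mul_swap t (m 0))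
    rw [ExteriorAlgebra.ιMulti_succ_apply, ExteriorAlgebra.ιMulti_succ_apply, h 0, ← mul_assoc,
      ← mul_assoc, map_add, map_smul, mul_add, mul_smul_comm, ExteriorAlgebra.ι_sq_zero, smul_zero,
      add_zero, swap, neg_mul, neg_mul, mul_assoc, mul_assoc, ih]

end Shear

/-! ### Fixed vectors and invariants for the Young subgroup. -/

section PartModules

variable {V : Type*} [Fintype V]

instance (s : Setoid V) (j : ℕ) : FiniteDimensional ℂ (PartModule s j) := by
  classical
  exact inferInstanceAs (FiniteDimensional ℂ
    (Representation.coindV (youngSubgroup s).subtype (extRep (reducedRep s) j)))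

lemma finrank_reducedSpace_le (s : Setoid V) :
    Module.finrank ℂ (reducedSpace s) ≤ Fintype.card V :=
  (Submodule.finrank_le _).trans (by simp)

/-- If `κ` is not constant on the blocks of `s`, the permutations in the Young subgroup of `s`
that preserve `κ` have a common nonzero fixed vector. -/
lemma exists_fixed_vector (s : Setoid V) (κ : V → ℕ) (hκ : ¬ ∀ v w, s v w → κ v = κ w) :
    ∃ f : reducedSpace s, f ≠ 0 ∧
      ∀ g : youngSubgroup s, (∀ v, κ ((g : Equiv.Perm V) v) = κ v) → reducedRep s g f = f := by
  push Not at hκ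
  obtain ⟨a, b, hab, hne⟩ := hκ
  -- The indicator of one colour class is preserved with `κ`. Centring subtracts the same average at
  -- `a` and `b`, so the values there still differ by 1 and the result is nonzero.
  let f₀ : V → ℂ := fun v => if κ v = κ a then 1 else 0
  refine ⟨⟨centre s f₀, centre_mem s f₀⟩, fun h => ?_, fun g hg => Subtype.ext ?_⟩
  · have h1 := congrFun (congrArg Subtype.val h) a
    have h2 := congrFun (congrArg Subtype.val h) b
    simp only [centre_apply, f₀, ZeroMemClass.coe_zero, Pi.zero_apply, if_neg hne.symm] at h1 h2
    rw [← blockSum_congr s _ hab, ← blockSize_congr s hab] at h2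
    simp only [if_true] at h1
    have : (1 : ℂ) = 0 := by linear_combination h1 - h2
    exact one_ne_zero this
  · change permRep V g (centre s f₀) = centre s f₀
    rw [← centre_permRep s g.2]
    congr 1
    funext v
    rw [permRep_apply]
    have := hg ((g : Equiv.Perm V)⁻¹ v)
    rw [show (g : Equiv.Perm V) ((g : Equiv.Perm V)⁻¹ v) = v from
      Equiv.apply_symm_apply (g : Equiv.Perm V) v] at this
    simp only [f₀, this]

lemma single_sub_single_mem [DecidableEq V] {s : Setoid V} {a b : V} (h : s a b) :
    (Pi.single a 1 - Pi.single b 1 : V → ℂ) ∈ reducedSpace s := by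
  classical
  intro v
  have : s a v ↔ s b v := ⟨fun h' => s.trans' (s.symm' h) h', fun h' => s.trans' h h'⟩
  simp [blockSum, this]

/-- The space `reducedSpace s` is spanned by differences of basis vectors. -/
lemma span_single_sub_single [DecidableEq V] (s : Setoid V) :
    Submodule.span ℂ {f : reducedSpace s | ∃ a b, s a b ∧
      f.1 = Pi.single a 1 - Pi.single b 1} = ⊤ := by
  classical
  rw [eq_top_iff]
  rintro f -
  -- With `r v` a representative of the block of `v`, `f` is the sum of the `f(v) (δ_v - δ_{r v})`:
  -- the subtracted terms collect to block sums of `f`, which are zero.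
  let r : V → V := fun v => (Quotient.mk s v).out
  have hr : ∀ v, s v (r v) := fun v => s.symm' (Quotient.mk_out v)
  have key : f = ∑ v, f.1 v • (⟨_, single_sub_single_mem (hr v)⟩ : reducedSpace s) := by
    refine Subtype.ext (funext fun w => ?_)
    rw [Submodule.coe_sum, Finset.sum_apply]
    simp only [Submodule.coe_smul, Pi.smul_apply, Pi.sub_apply, smul_eq_mul, mul_sub,
      Finset.sum_sub_distrib]
    have h1 : ∑ v, f.1 v * (Pi.single v 1 : V → ℂ) w = f.1 w := by
      simp [Pi.single_apply]
    have h2 : ∑ v, f.1 v * (Pi.single (r v) 1 : V → ℂ) w = 0 := by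
      simp only [Pi.single_apply, mul_ite, mul_one, mul_zero]
      rw [← Finset.sum_filter]
      by_cases hw : r w = w
      · have h := f.2 w
        rw [blockSum] at h
        rw [← h]
        refine Finset.sum_congr (Finset.filter_congr fun v _ => ?_) fun _ _ => rfl
        constructor
        · intro h
          rw [h]
          exact hr v
        · intro h
          rw [← hw]
          exact congrArg Quotient.out (Quotient.sound (s.symm' h))
      · refine Finset.sum_eq_zero fun v hv => absurd ?_ hw
        have hv := (Finset.mem_filter.mp hv).2
        conv_rhs => rw [hv]
        refine congrArg Quotient.out (Quotient.sound ?_)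
        rw [hv]
        exact s.symm' (hr v)
    rw [h1, h2, sub_zero]
  rw [key]
  exact Submodule.sum_mem _ fun v _ => Submodule.smul_mem _ _ <|
    Submodule.subset_span ⟨v, r v, hr v, rfl⟩

/-- No nonzero vector of positive degree in `⋀* (reducedSpace s)` is invariant under the Young
subgroup of `s`: the average over the group vanishes. -/
lemma sum_extRep_succ (s : Setoid V) [Fintype (youngSubgroup s)] (j : ℕ) :
    ∑ g : youngSubgroup s, extRep (reducedRep s) (j + 1) g = 0 := by
  classical
  refine LinearMap.ext_on (exteriorPower.ιMulti_span_of_span ℂ (j + 1) _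
    (span_single_sub_single s)) ?_
  rintro _ ⟨m, hm, rfl⟩
  obtain ⟨a, b, hab, h0⟩ := hm (Set.mem_range_self 0)
  rw [LinearMap.zero_apply]
  by_cases hne : a = b
  · rw [(exteriorPower.ιMulti ℂ (j + 1)).map_coord_zero 0, map_zero]
    exact Subtype.ext (by rw [h0, hne, sub_self]; rfl)
  -- The transposition of `a` and `b` negates `m 0 = δ_a - δ_b` and shifts every vector by a
  -- multiple of it, so it negates the wedge product. The group sum absorbs `τ`, hence equals its
  -- own negative on this product.
  let τ : youngSubgroup s := ⟨Equiv.swap a b, fun v => by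
    rcases eq_or_ne v a with rfl | ha
    · rw [Equiv.swap_apply_left]; exact s.symm' hab
    · rcases eq_or_ne v b with rfl | hb
      · rw [Equiv.swap_apply_right]; exact hab
      · rw [Equiv.swap_apply_of_ne_of_ne ha hb]⟩
  have hτ : ∀ f : reducedSpace s, reducedRep s τ f = f + (f.1 b - f.1 a) • m 0 := fun f => by
    refine Subtype.ext (funext fun v => ?_)
    rw [coe_reducedRep_apply, Submodule.coe_add, Submodule.coe_smul, h0]
    change f.1 ((Equiv.swap a b)⁻¹ v) = _
    rw [Equiv.swap_inv, Pi.add_apply, Pi.smul_apply, Pi.sub_apply, smul_eq_mul]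
    rcases eq_or_ne v a with rfl | ha
    · simp [hne]
    · rcases eq_or_ne v b with rfl | hb
      · simp [Ne.symm hne]
      · simp [Equiv.swap_apply_of_ne_of_ne ha hb, ha, hb]
  have hτ0 : reducedRep s τ (m 0) = -m 0 := by
    rw [hτ, h0]
    simp only [Pi.sub_apply, Pi.single_eq_same, Pi.single_apply, if_neg hne,
      if_neg (Ne.symm hne)]
    module
  have hneg : extRep (reducedRep s) (j + 1) τ (exteriorPower.ιMulti ℂ (j + 1) m) =
      -exteriorPower.ιMulti ℂ (j + 1) m := by
    rw [extRep_apply, exteriorPower.map_apply_ιMulti]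
    refine Subtype.ext ?_
    rw [Submodule.coe_neg, exteriorPower.ιMulti_apply_coe, exteriorPower.ιMulti_apply_coe,
      ExteriorAlgebra.ιMulti_succ_apply, ExteriorAlgebra.ιMulti_succ_apply, Function.comp_apply,
      hτ0, map_neg, neg_mul]
    exact congrArg Neg.neg (ι_mul_ιMulti_of_shear (m 0) (Matrix.vecTail m) _ _ fun i => hτ _)
  have hinv : (∑ g : youngSubgroup s, extRep (reducedRep s) (j + 1) g) *
      extRep (reducedRep s) (j + 1) τ = ∑ g : youngSubgroup s, extRep (reducedRep s) (j + 1) g := by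
    rw [Finset.sum_mul]
    exact Fintype.sum_equiv (Equiv.mulRight τ) _ _ fun g => (map_mul _ _ _).symm
  have h := LinearMap.congr_fun hinv (exteriorPower.ιMulti ℂ (j + 1) m)
  rw [Module.End.mul_apply, hneg, map_neg] at h
  have h2 := neg_eq_iff_add_eq_zero.mp h
  rwa [← two_smul ℂ, smul_eq_zero_iff_right two_ne_zero] at h2

end PartModules

/-! ### The alternating characteristic of a partition module. -/

section PartCharacters

variable {V : Type*} [Fintype V]

lemma extRep_zero_character (s : Setoid V) (g : youngSubgroup s) :
    (extRep (reducedRep s) 0).character g = 1 := by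
  have h : extRep (reducedRep s) 0 g = LinearMap.id := by
    refine exteriorPower.linearMap_ext (AlternatingMap.ext fun m => ?_)
    rw [LinearMap.compAlternatingMap_apply, extRep_apply, exteriorPower.map_apply_ιMulti,
      LinearMap.compAlternatingMap_apply, LinearMap.id_apply]
    exact congrArg _ (Subsingleton.elim _ _)
  rw [Representation.character, h, LinearMap.trace_id, exteriorPower.finrank_eq, Nat.choose_zero_right,
    Nat.cast_one]

lemma sum_extRep_succ_character (s : Setoid V) [Fintype (youngSubgroup s)] (j : ℕ) :
    ∑ g : youngSubgroup s, (extRep (reducedRep s) (j + 1)).character g = 0 := by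
  simp only [Representation.character]
  rw [← map_sum, sum_extRep_succ, map_zero]

variable [DecidableEq V]

-- For `κ` constant on blocks every `g` counts, and only `Λ⁰` has invariants. Otherwise each
-- contributing `g` fixes a nonzero vector, which kills its alternating trace.
omit [DecidableEq V] in
open Classical in
lemma average_alternating_character (s : Setoid V) [Fintype (youngSubgroup s)] (κ : V → ℕ) :
    (Fintype.card (youngSubgroup s) : ℂ)⁻¹ * ∑ g : youngSubgroup s,
      (if ∀ v, κ ((g : Equiv.Perm V) v) = κ v then
        ∑ j ∈ Finset.range (Fintype.card V + 1), (-1 : ℂ) ^ j *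
          (extRep (reducedRep s) j).character g else 0) =
      if ∀ v w, s v w → κ v = κ w then 1 else 0 := by
  split_ifs with hκ
  · rw [Finset.sum_congr rfl fun (g : youngSubgroup s) _ => if_pos fun v => hκ _ _ (g.2 v),
      Finset.sum_comm]
    simp only [← Finset.mul_sum]
    rw [Finset.sum_range_succ']
    simp only [sum_extRep_succ_character, extRep_zero_character]
    simp
  · obtain ⟨f, hf, hfix⟩ := exists_fixed_vector s κ hκ
    rw [Finset.sum_eq_zero, mul_zero]
    intro g _
    split_ifs with h
    · exact alternating_sum_trace_exteriorPower_eq_zero (reducedRep s g) hf (hfix g h)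
        (finrank_reducedSpace_le s)
    · rfl

open Classical in
/-- The alternating sum over `j` of the Frobenius characteristics of `(M_F)_j` is the power sum of
the partition into blocks, whose coefficients count colourings constant on the blocks. -/
lemma alternating_sum_partRep (s : Setoid V) (m : ℕ →₀ ℕ) :
    ∑ j ∈ Finset.range (Fintype.card V + 1), (-1 : ℂ) ^ j *
      (((Fintype.card V).factorial : ℂ)⁻¹ * ∑ σ : Equiv.Perm V, (partRep s j).character σ *
        MvPowerSeries.coeff m (σ.partition.parts.map powerSum).prod) =
      ((colourings V m).filter fun κ => ∀ v w, s v w → κ v = κ w).card := by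
  -- Conjugate permutations have the same cycle type, so the power sum coefficient is a class
  -- function, as reciprocity requires.
  have hclass : ∀ x g : Equiv.Perm V,
      MvPowerSeries.coeff m ((x * g * x⁻¹).partition.parts.map powerSum).prod =
      MvPowerSeries.coeff m (g.partition.parts.map powerSum).prod := fun x g => by
    have : g.partition = (x * g * x⁻¹).partition :=
      Equiv.Perm.partition_eq_of_isConj.mp (isConj_iff.mpr ⟨x, rfl⟩)
    rw [this]
  have hj : ∀ j, ((Fintype.card V).factorial : ℂ)⁻¹ * ∑ σ : Equiv.Perm V,
      (partRep s j).character σ * MvPowerSeries.coeff m (σ.partition.parts.map powerSum).prod =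
      (Fintype.card (youngSubgroup s) : ℂ)⁻¹ * ∑ g : youngSubgroup s,
        (extRep (reducedRep s) j).character g *
          ∑ κ ∈ colourings V m, if ∀ v, κ ((g : Equiv.Perm V) v) = κ v then 1 else 0 := fun j => by
    have h := sum_coind_character_mul (youngSubgroup s) (extRep (reducedRep s) j)
      (P := fun g => MvPowerSeries.coeff m (g.partition.parts.map powerSum).prod) hclass
    rw [Fintype.card_perm] at h
    refine h.trans ?_
    congr 1
    refine Finset.sum_congr rfl fun g _ => ?_
    rw [coeff_prod_powerSum, Finset.sum_boole]
  simp only [hj]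
  rw [Finset.card_filter, Nat.cast_sum]
  have hκ := average_alternating_character s
  calc _ = ∑ κ ∈ colourings V m, (Fintype.card (youngSubgroup s) : ℂ)⁻¹ *
        ∑ g : youngSubgroup s, (if ∀ v, κ ((g : Equiv.Perm V) v) = κ v then
          ∑ j ∈ Finset.range (Fintype.card V + 1), (-1 : ℂ) ^ j *
            (extRep (reducedRep s) j).character g else 0) := by
        simp only [Finset.mul_sum]
        rw [Finset.sum_comm]
        conv_rhs => rw [Finset.sum_comm]
        refine Finset.sum_congr rfl fun g _ => ?_
        rw [Finset.sum_comm]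
        refine Finset.sum_congr rfl fun κ _ => ?_
        split_ifs
        · rw [Finset.mul_sum]
          exact Finset.sum_congr rfl fun j _ => by ring
        · simp
    _ = _ := by
        refine Finset.sum_congr rfl fun κ _ => ?_
        rw [hκ]
        push_cast
        rfl

end PartCharacters

/-! ### Euler characteristic: from homology to chains. -/

section Euler

variable {α β : Type*} (G : Graph α β) [LinearOrder E(G)] [Fintype V(G)] [Fintype E(G)]

instance (i : ℕ) : Fintype (State G i) := by
  classical
  exact inferInstanceAs (Fintype {F : Finset E(G) // F.card = i})

instance (i j : ℕ) : FiniteDimensional ℂ (ChainModule G i j) :=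
  inferInstanceAs (Module.Finite ℂ (Π₀ F : State G i, PartModule (components G F.1) j))

lemma chainRep_character (i j : ℕ) (g : Equiv.Perm V(G)) :
    (chainRep G i j).character g =
      ∑ F : State G i, (partRep (components G F.1) j).character g := by
  rw [Representation.character, trace_eq_sum_of_decomposition
    (fun F => DirectSum.lof ℂ (State G i) (fun F => PartModule (components G F.1) j) F)
    (fun F => DirectSum.component ℂ (State G i) (fun F => PartModule (components G F.1) j) F)]
  · refine Finset.sum_congr rfl fun F _ => congrArg _ (LinearMap.ext fun x => ?_)
    simp only [LinearMap.comp_apply]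
    rw [chainRep_lof, DirectSum.component.lof_self]
  · refine DirectSum.linearMap_ext ℂ fun F => LinearMap.ext fun x => ?_
    rw [LinearMap.comp_apply, LinearMap.sum_apply, Finset.sum_eq_single F]
    · rw [LinearMap.comp_apply, DirectSum.component.lof_self]
      rfl
    · intro F' _ hne
      rw [LinearMap.comp_apply, DirectSum.component.of, dif_neg hne.symm, map_zero]
    · simp

/-- The short exact sequence is boundaries → cycles → homology. -/
lemma homologyRep_character (i j : ℕ) (g : Equiv.Perm V(G)) :
    (cycles G i j).toRepresentation.character g =
      (boundaries G i j).toRepresentation.character g + (homologyRep G i j).character g := by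
  refine trace_eq_add_of_exact
    (i := Submodule.inclusion (boundaries_le_cycles G i j))
    (p := Submodule.mkQ _) (Submodule.inclusion_injective _) (Submodule.mkQ_surjective _) ?_ rfl rfl
  intro x
  rw [Submodule.mkQ_apply, Submodule.Quotient.mk_eq_zero]
  exact ⟨fun h => ⟨⟨x.1, h⟩, rfl⟩, by rintro ⟨y, rfl⟩; exact y.2⟩

/-- The short exact sequence is cycles → chains → boundaries one degree lower, equivariant because
the differential is. -/
lemma chainRep_succ_character (i j : ℕ) (g : Equiv.Perm V(G)) :
    (chainRep G (i + 1) j).character g = (cycles G (i + 1) j).toRepresentation.character g +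
      (boundaries G i j).toRepresentation.character g := by
  refine trace_eq_add_of_exact (i := (cycles G (i + 1) j).toSubmodule.subtype)
    (p := (differential G i j).toLinearMap.rangeRestrict) Subtype.val_injective
    (LinearMap.surjective_rangeRestrict _) ?_ rfl ?_
  · intro x
    constructor
    · intro h
      exact ⟨⟨x, congrArg Subtype.val h⟩, rfl⟩
    · rintro ⟨y, rfl⟩
      exact Subtype.ext y.2
  · exact LinearMap.ext fun x => Subtype.ext (differentialAux_chainRep G i j g x)

omit [Fintype E(G)] in
lemma chainRep_zero_character (j : ℕ) (g : Equiv.Perm V(G)) :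
    (chainRep G 0 j).character g = (cycles G 0 j).toRepresentation.character g := by
  exact LinearMap.trace_conj' ((cycles G 0 j).toRepresentation g)
    (LinearEquiv.ofTop (cycles G 0 j).toSubmodule rfl)

/-- No state has more than `|E(G)|` edges, so nothing maps into the top degree. -/
lemma boundaries_character_card (j : ℕ) (g : Equiv.Perm V(G)) :
    (boundaries G (Fintype.card E(G)) j).toRepresentation.character g = 0 := by
  have h0 : ∀ x : (boundaries G (Fintype.card E(G)) j).toSubmodule, x = 0 := by
    rintro ⟨_, x, rfl⟩
    have : IsEmpty (State G (Fintype.card E(G) + 1)) :=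
      ⟨fun F => by have := F.1.card_le_univ; have := F.2; omega⟩
    refine Subtype.ext ?_
    have hx : x = 0 := DFinsupp.ext fun F => isEmptyElim F
    rw [hx]
    exact map_zero (differential G _ j).toLinearMap
  have : (boundaries G (Fintype.card E(G)) j).toRepresentation g = 0 :=
    LinearMap.ext fun x => h0 _
  rw [Representation.character, this, map_zero]

/-- The Euler characteristic of the chain complex. -/
lemma sum_homologyRep_character (j : ℕ) (g : Equiv.Perm V(G)) :
    ∑ i ∈ Finset.range (Fintype.card E(G) + 1), (-1 : ℂ) ^ i * (homologyRep G i j).character g =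
      ∑ i ∈ Finset.range (Fintype.card E(G) + 1), (-1 : ℂ) ^ i * (chainRep G i j).character g := by
  -- Truncating at `N` leaves one uncancelled term, the boundaries arriving from degree `N + 1`; it
  -- vanishes at `N = |E(G)|`.
  have h : ∀ N, ∑ i ∈ Finset.range (N + 1), (-1 : ℂ) ^ i * (homologyRep G i j).character g =
      ∑ i ∈ Finset.range (N + 1), (-1 : ℂ) ^ i * (chainRep G i j).character g -
        (-1) ^ N * (boundaries G N j).toRepresentation.character g := by
    intro N
    induction N with
    | zero =>
      have := homologyRep_character G 0 j g
      simp only [zero_add, Finset.sum_range_one, pow_zero, one_mul, chainRep_zero_character]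
      rw [this]
      ring
    | succ N ih =>
      rw [Finset.sum_range_succ, ih, Finset.sum_range_succ _ (N + 1), chainRep_succ_character,
        homologyRep_character, pow_succ]
      ring
  rw [h, boundaries_character_card, mul_zero, sub_zero]

lemma sum_chainRep_character (j : ℕ) (g : Equiv.Perm V(G)) :
    ∑ i ∈ Finset.range (Fintype.card E(G) + 1), (-1 : ℂ) ^ i * (chainRep G i j).character g =
      ∑ F : Finset E(G), (-1 : ℂ) ^ F.card * (partRep (components G F) j).character g := by
  classical
  rw [← Finset.sum_fiberwise_of_maps_to (s := Finset.univ) (g := Finset.card)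
    (t := Finset.range (Fintype.card E(G) + 1))
    fun F _ => Finset.mem_range.mpr (Nat.lt_succ_of_le F.card_le_univ)]
  refine Finset.sum_congr rfl fun i _ => ?_
  rw [chainRep_character, Finset.mul_sum]
  refine ((Finset.sum_subtype (F := inferInstanceAs (Fintype (State G i))) _
    (p := fun F : Finset E(G) => F.card = i) (fun F => by simp)
    fun F => (-1 : ℂ) ^ F.card * (partRep (components G F) j).character g).trans ?_).symm
  refine Finset.sum_congr rfl fun F _ => ?_
  rw [F.2]

end Euler

/-! ### Inclusion-exclusion over edge sets. -/

section InclusionExclusion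

variable {α β : Type*} (G : Graph α β) [Fintype V(G)] [Fintype E(G)]

omit [Fintype V(G)] [Fintype E(G)] in
lemma const_on_components_iff (F : Finset E(G)) (κ : V(G) → ℕ) :
    (∀ v w, components G F v w → κ v = κ w) ↔
      ∀ e ∈ F, ∀ x y : V(G), G.IsLink e x y → κ x = κ y := by
  constructor
  · exact fun h e he x y hl => h x y (.rel _ _ ⟨e, he, hl⟩)
  · intro h v w hvw
    induction hvw with
    | rel x y hl => obtain ⟨e, he, hl⟩ := hl; exact h e he x y hl
    | refl => rfl
    | symm _ _ _ ih => exact ih.symm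
    | trans _ _ _ _ _ ih ih' => exact ih.trans ih'

-- The contributing `F` are the subsets of the set `M` of monochromatic edges, and the signed sum
-- over subsets of `M` is zero unless `M` is empty. Loops always lie in `M`.
open Classical in
lemma sum_const_on_components (κ : V(G) → ℕ) :
    ∑ F : Finset E(G), (-1 : ℂ) ^ F.card *
      (if ∀ v w, components G F v w → κ v = κ w then 1 else 0) =
      if IsProperColouring G κ then 1 else 0 := by
  let M : Finset E(G) := {e | ∀ x y : V(G), G.IsLink e x y → κ x = κ y}
  have h1 : ∀ F : Finset E(G), (∀ v w, components G F v w → κ v = κ w) ↔ F ∈ M.powerset :=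
    fun F => by
      rw [const_on_components_iff, Finset.mem_powerset]
      exact ⟨fun h e he => Finset.mem_filter.mpr ⟨Finset.mem_univ _, h e he⟩,
        fun h e he => (Finset.mem_filter.mp (h he)).2⟩
  have h2 : IsProperColouring G κ ↔ M = ∅ := by
    constructor
    · intro h
      refine Finset.eq_empty_of_forall_notMem fun e he => ?_
      obtain ⟨x, y, hl⟩ := Graph.exists_isLink_of_mem_edgeSet e.2
      exact h e ⟨x, hl.left_mem⟩ ⟨y, hl.right_mem⟩ hl ((Finset.mem_filter.mp he).2 _ _ hl)
    · intro h e x y hl hxy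
      refine Finset.notMem_empty (⟨e, hl.edge_mem⟩ : E(G)) (h ▸ Finset.mem_filter.mpr
        ⟨Finset.mem_univ _, fun x' y' hl' => ?_⟩)
      -- An edge determines its ends up to order, so equal colours for one ordered pair of ends
      -- suffice for membership in `M`.
      rcases hl.eq_and_eq_or_eq_and_eq hl' with ⟨h1, h2⟩ | ⟨h1, h2⟩
      · rw [← Subtype.ext h1, ← Subtype.ext h2, hxy]
      · rw [← Subtype.ext h1, ← Subtype.ext h2, hxy]
  simp only [h1, mul_ite, mul_one, mul_zero]
  rw [← Finset.sum_filter, Finset.filter_univ_mem]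
  have h3 := congrArg (Int.cast : ℤ → ℂ) (Finset.sum_powerset_neg_one_pow_card (x := M))
  push_cast at h3
  rw [h3]
  simp only [h2]

end InclusionExclusion

end ChromaticHomology

/-! ### Comparison of coefficients. -/

open ChromaticHomology in
theorem theorem2p7 {α β : Type*} (G : Graph α β) [Fintype V(G)] [DecidableEq V(G)]
    [Fintype E(G)] [LinearOrder E(G)] :
    ChromaticHomology.frobeniusSeries G 1 1 = ChromaticHomology.chromaticSymmetricFunction G := by
  classical
  ext m
  let n := Fintype.card V(G)
  let P : Equiv.Perm V(G) → ℂ := fun σ =>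
    MvPowerSeries.coeff m (σ.partition.parts.map powerSum).prod
  have hR : MvPowerSeries.coeff m (chromaticSymmetricFunction G) =
      ((colourings V(G) m).filter fun κ => IsProperColouring G κ).card := by
    change ((Set.ncard _ : ℕ) : ℂ) = _
    rw [← Set.ncard_coe_finset]
    congr 2
    ext κ
    simp [mem_colourings, and_comm]
  -- The sum over `i` is brought innermost, next to the homology characters, so that the Euler
  -- characteristic applies for each fixed `j` and `σ`.
  have hL : MvPowerSeries.coeff m (frobeniusSeries G 1 1) =
      ∑ j ∈ Finset.range (n + 1), (-1 : ℂ) ^ j * ((n.factorial : ℂ)⁻¹ * ∑ σ : Equiv.Perm V(G),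
        (∑ i ∈ Finset.range (Fintype.card E(G) + 1),
          (-1 : ℂ) ^ i * (homologyRep G i j).character σ) * P σ) := by
    simp only [frobeniusSeries, frobChar, map_sum, map_smul, smul_eq_mul, one_pow, mul_one]
    rw [Finset.sum_comm]
    refine Finset.sum_congr rfl fun j _ => ?_
    simp only [Finset.sum_mul]
    rw [Finset.sum_comm (s := Finset.univ), Finset.mul_sum, Finset.mul_sum]
    refine Finset.sum_congr rfl fun i _ => ?_
    simp only [mul_assoc]
    rw [← Finset.mul_sum]
    ring
  rw [hL, hR]
  simp only [sum_homologyRep_character, sum_chainRep_character]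
  calc _ = ∑ F : Finset E(G), (-1 : ℂ) ^ F.card * ∑ j ∈ Finset.range (n + 1), (-1 : ℂ) ^ j *
        ((n.factorial : ℂ)⁻¹ * ∑ σ : Equiv.Perm V(G),
          (partRep (components G F) j).character σ * P σ) := by
        simp only [Finset.sum_mul, Finset.mul_sum]
        rw [Finset.sum_comm (s := Finset.univ (α := Finset E(G)))]
        refine Finset.sum_congr rfl fun j _ => ?_
        rw [Finset.sum_comm (s := Finset.univ (α := Finset E(G)))]
        exact Finset.sum_congr rfl fun σ _ => Finset.sum_congr rfl fun F _ => by ring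
    _ = ∑ F : Finset E(G), (-1 : ℂ) ^ F.card * ∑ κ ∈ colourings V(G) m,
        (if ∀ v w, components G F v w → κ v = κ w then 1 else 0) := by
        refine Finset.sum_congr rfl fun F _ => ?_
        rw [alternating_sum_partRep, Finset.sum_boole]
    _ = ∑ κ ∈ colourings V(G) m, if IsProperColouring G κ then 1 else 0 := by
        simp only [Finset.mul_sum]
        rw [Finset.sum_comm]
        refine Finset.sum_congr rfl fun κ _ => ?_
        rw [← sum_const_on_components]
    _ = _ := Finset.sum_boole _ _

end
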